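/- **Definitions.** An *extended surface* $\Sigma$ is a compact oriented smooth $2$-manifold, possibly with boundary and possibly disconnected, with one marked point chosen on every boundary circle. The *genus* of a surface is the genus of the surface without boundary obtained by gluing a disk to every boundary circle; equivalently, it is the maximal number of pairwise disjoint smooth simple closed curves in the interior whose removal does not disconnect any connected component. A *cut system* on $\Sigma$ is a finite (possibly empty) set $C$ of pairwise disjoint smooth simple closed curves ("cuts", neither oriented nor ordered) in the interior of $\Sigma$ such that every connected component of $\Sigma\setminus C$ has genus $0$. A cut $c\in C$ is *removable* if $C\setminus\{c\}$ is again a cut system. Everything is considered up to isotopy of $\Sigma$ (ambient isotopy fixing the marked points). Let $\mathcal C(\Sigma)$ be the following $2$-dimensional CW complex. * Its vertices are the isotopy classes of cut systems on $\Sigma$. * Its directed edges are the moves $\bar F_c\colon C\to C\setminus\{c\}$, one for each isotopy class of pairs consisting of a cut system $C$ and a removable cut $c\in C$. * Its $2$-cells are the relations of associativity of cut removal, $\bar F_{c_1}\bar F_{c_2}(C)=\bar F_{c_2}\bar F_{c_1}(C)$: for each isotopy class of a cut system $C$ with an unordered pair of distinct cuts $c_1,c_2\in C$ such that $C\setminus\{c_1\}$,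 $C\setminus\{c_2\}$ and $C\setminus\{c_1,c_2\}$ are cut systems, one square is attached along the two edge paths $C\to C\setminus\{c_1\}\to C\setminus\{c_1,c_2\}$ and $C\to C\setminus\{c_2\}\to C\setminus\{c_1,c_2\}$. **Theorem.** If $\Sigma$ is an extended surface of genus $0$, then $\mathcal C(\Sigma)$ is connected and simply-connected. -/

import Mathlib

open Set Topology
open scoped Manifold ContDiff unitInterval

noncomputable section

namespace CutComplex

universe u

/-! ### Moving collections of curves -/

section Move

variable {M : Type u} [TopologicalSpace M]

/-- The collection of the images of the curves of `C` under `φ`. -/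
def moveCurves (φ : M ≃ₜ M) (C : Set (Set M)) : Set (Set M) := (fun c => φ '' c) '' C

theorem moveCurves_refl (C : Set (Set M)) : moveCurves (Homeomorph.refl M) C = C := by
  simp [moveCurves]

theorem moveCurves_trans (φ ψ : M ≃ₜ M) (C : Set (Set M)) :
    moveCurves (φ.trans ψ) C = moveCurves ψ (moveCurves φ C) := by
  simp only [moveCurves, image_image]
  rfl

theorem image_symm_of_image {φ : M ≃ₜ M} {c c' : Set M} (h : φ '' c = c') :
    φ.symm '' c' = c := by
  simp [← h, image_image]

theorem moveCurves_symm {φ : M ≃ₜ M} {C C' : Set (Set M)} (h : moveCurves φ C = C') :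
    moveCurves φ.symm C' = C := by
  simp [← h, moveCurves, image_image]

theorem moveCurves_diff {φ : M ≃ₜ M} {C C' : Set (Set M)} {c c' : Set M}
    (h : moveCurves φ C = C') (hc : φ '' c = c') :
    moveCurves φ (C \ {c}) = C' \ {c'} := by
  rw [← h, ← hc]
  simp only [moveCurves]
  rw [image_sdiff φ.injective.image_injective, image_singleton]

end Move

/-! ### Extended surfaces, simple closed curves, genus -/

section Surface

variable (M : Type u) [TopologicalSpace M] [ChartedSpace (EuclideanHalfSpace 2) M]

/-- The structure of an extended surface on a smooth `2`-manifold with boundary `M`: an orientation,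
given by an atlas of smooth charts with orientation preserving coordinate changes, and one marked
point on every component of the boundary. (That `M` is smooth, compact and Hausdorff is asked for
by type classes.) -/
structure ESurface where
  /-- The positively oriented charts. -/
  orientedAtlas : Set (OpenPartialHomeomorph M (EuclideanHalfSpace 2))
  smooth_charts : orientedAtlas ⊆ IsManifold.maximalAtlas (𝓡∂ 2) ∞ M
  charts_cover : ∀ x : M, ∃ e ∈ orientedAtlas, x ∈ e.source
  det_pos : ∀ e ∈ orientedAtlas, ∀ e' ∈ orientedAtlas, ∀ x ∈ e.source ∩ e'.source,
    0 < (fderivWithin ℝ (e'.extend (𝓡∂ 2) ∘ (e.extend (𝓡∂ 2)).symm) (range (𝓡∂ 2))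
      (e.extend (𝓡∂ 2) x)).det
  /-- The marked points. -/
  marked : Set M
  marked_subset : marked ⊆ (𝓡∂ 2).boundary M
  existsUnique_marked : ∀ x ∈ (𝓡∂ 2).boundary M,
    ∃! p, p ∈ marked ∧ p ∈ connectedComponentIn ((𝓡∂ 2).boundary M) x

variable {M}

/-- An (unoriented, unparameterized) smooth simple closed curve in the interior of `M`. -/
def IsSimpleClosedCurve (c : Set M) : Prop :=
  (∃ γ : Circle → M, Manifold.IsSmoothEmbedding (𝓡 1) (𝓡∂ 2) ∞ γ ∧ range γ = c) ∧
    c ⊆ (𝓡∂ 2).interior M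

/-- A finite collection of pairwise non-intersecting smooth simple closed curves. -/
def IsCurveSystem (C : Set (Set M)) : Prop :=
  C.Finite ∧ (∀ c ∈ C, IsSimpleClosedCurve c) ∧ C.PairwiseDisjoint id

/-- Removing the curves of `F` from `U` disconnects no connected component of `U`. -/
def IsNonseparating (U : Set M) (F : Set (Set M)) : Prop :=
  ∀ x ∈ U, IsConnected (connectedComponentIn U x \ ⋃₀ F)

/-- The genus of a region `U` of `M`: the maximal number of non-intersecting simple closed curves
in the interior of `U` whose removal disconnects no component of `U`. Gluing disks to boundary
circles does not change this number, and it is additive over connected components. -/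
def genus (U : Set M) : ℕ∞ :=
  ⨆ F : {F : Set (Set M) // IsCurveSystem F ∧ ⋃₀ F ⊆ U ∧ IsNonseparating U F}, F.1.encard

/-- A cut system: a finite collection of non-intersecting simple closed curves such that each
connected component of the complement has genus `0`. -/
def IsCutSystem (C : Set (Set M)) : Prop :=
  IsCurveSystem C ∧ ∀ x ∈ (⋃₀ C)ᶜ, genus (connectedComponentIn (⋃₀ C)ᶜ x) = 0

namespace ESurface

variable (S : ESurface M)

/-- The genus of the surface. -/
def surfaceGenus (_S : ESurface M) : ℕ∞ := genus (univ : Set M)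

/-- `φ` is the end of an isotopy of the surface which starts at the identity and keeps the marked
points fixed. -/
def IsotopicToId (φ : M ≃ₜ M) : Prop :=
  ∃ H : I → M ≃ₜ M, Continuous (fun p : I × M => H p.1 p.2) ∧
    Continuous (fun p : I × M => (H p.1).symm p.2) ∧
    H 0 = Homeomorph.refl M ∧ H 1 = φ ∧ ∀ t, ∀ p ∈ S.marked, H t p = p

variable {S}

theorem IsotopicToId.refl : S.IsotopicToId (Homeomorph.refl M) :=
  ⟨fun _ => Homeomorph.refl M, continuous_snd, continuous_snd, rfl, rfl, fun _ _ _ => rfl⟩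

theorem IsotopicToId.symm {φ : M ≃ₜ M} (h : S.IsotopicToId φ) : S.IsotopicToId φ.symm := by
  obtain ⟨H, h1, h2, h3, h4, h5⟩ := h
  refine ⟨fun t => (H t).symm, h2, h1, ?_, ?_, fun t p hp => ?_⟩
  · simp only [h3]; rfl
  · simp only [h4]
  · rw [Homeomorph.symm_apply_eq, h5 t p hp]

theorem IsotopicToId.trans {φ ψ : M ≃ₜ M} (h : S.IsotopicToId φ) (h' : S.IsotopicToId ψ) :
    S.IsotopicToId (φ.trans ψ) := by
  obtain ⟨H, h1, h2, h3, h4, h5⟩ := h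
  obtain ⟨K, k1, k2, k3, k4, k5⟩ := h'
  refine ⟨fun t => (H t).trans (K t), ?_, ?_, ?_, ?_, fun t p hp => ?_⟩
  · exact k1.comp (continuous_fst.prodMk h1)
  · exact h2.comp (continuous_fst.prodMk k2)
  · simp only [h3, k3]; rfl
  · simp only [h4, k4]
  · simp [h5 t p hp, k5 t p hp]

end ESurface

variable (M)

/-- A cut system. -/
structure CutSystem where
  cuts : Set (Set M)
  isCutSystem : IsCutSystem cuts

/-- A cut system with a removable cut `c`. -/
structure PointedCutSystem where
  cuts : Set (Set M)
  c : Set M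
  mem : c ∈ cuts
  isCutSystem : IsCutSystem cuts
  removable : IsCutSystem (cuts \ {c})

/-- A cut system with two distinct cuts which can be removed one after the other, in any order. -/
structure BipointedCutSystem where
  cuts : Set (Set M)
  c₁ : Set M
  c₂ : Set M
  mem₁ : c₁ ∈ cuts
  mem₂ : c₂ ∈ cuts
  ne : c₁ ≠ c₂
  isCutSystem : IsCutSystem cuts
  removable₁ : IsCutSystem (cuts \ {c₁})
  removable₂ : IsCutSystem (cuts \ {c₂})
  removable₁₂ : IsCutSystem ((cuts \ {c₁}) \ {c₂})

variable {M}

namespace PointedCutSystem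

/-- The cut system from which the cut is to be removed. -/
def before (p : PointedCutSystem M) : CutSystem M := ⟨p.cuts, p.isCutSystem⟩

/-- The cut system that remains after the cut is removed. -/
def after (p : PointedCutSystem M) : CutSystem M := ⟨p.cuts \ {p.c}, p.removable⟩

end PointedCutSystem

namespace BipointedCutSystem

variable (q : BipointedCutSystem M)

/-- Remove `c₁` from `C`. -/
def first₁ : PointedCutSystem M := ⟨q.cuts, q.c₁, q.mem₁, q.isCutSystem, q.removable₁⟩

/-- Remove `c₂` from `C`. -/
def first₂ : PointedCutSystem M := ⟨q.cuts, q.c₂, q.mem₂, q.isCutSystem, q.removable₂⟩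

/-- Remove `c₂` from `C \ {c₁}`. -/
def second₂ : PointedCutSystem M :=
  ⟨q.cuts \ {q.c₁}, q.c₂, ⟨q.mem₂, fun h => q.ne h.symm⟩, q.removable₁, q.removable₁₂⟩

/-- Remove `c₁` from `C \ {c₂}`. -/
def second₁ : PointedCutSystem M :=
  ⟨q.cuts \ {q.c₂}, q.c₁, ⟨q.mem₁, fun h => q.ne h⟩, q.removable₂, by
    rw [_root_.sdiff_sdiff_comm]; exact q.removable₁₂⟩

end BipointedCutSystem

/-! ### Isotopy classes -/

namespace ESurface

variable (S : ESurface M)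

/-- Isotopy of cut systems. -/
def cutSetoid : Setoid (CutSystem M) where
  r C C' := ∃ φ, S.IsotopicToId φ ∧ moveCurves φ C.cuts = C'.cuts
  iseqv :=
    { refl := fun C => ⟨_, .refl, moveCurves_refl _⟩
      symm := fun ⟨φ, h, h'⟩ => ⟨φ.symm, h.symm, moveCurves_symm h'⟩
      trans := fun ⟨φ, h, h'⟩ ⟨ψ, k, k'⟩ =>
        ⟨φ.trans ψ, h.trans k, by rw [moveCurves_trans, h', k']⟩ }

/-- Isotopy of cut systems with a removable cut. -/
def pointedSetoid : Setoid (PointedCutSystem M) where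
  r p p' := ∃ φ, S.IsotopicToId φ ∧ moveCurves φ p.cuts = p'.cuts ∧ φ '' p.c = p'.c
  iseqv :=
    { refl := fun p => ⟨_, .refl, moveCurves_refl _, by simp⟩
      symm := fun ⟨φ, h, h', h''⟩ =>
        ⟨φ.symm, h.symm, moveCurves_symm h', image_symm_of_image h''⟩
      trans := fun ⟨φ, h, h', h''⟩ ⟨ψ, k, k', k''⟩ =>
        ⟨φ.trans ψ, h.trans k, by rw [moveCurves_trans, h', k'], by
          rw [← k'', ← h'', image_image]; rfl⟩ }

/-- Isotopy of cut systems with two distinguished cuts, the order of the two being irrelevant. -/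
def bipointedSetoid : Setoid (BipointedCutSystem M) where
  r q q' := ∃ φ, S.IsotopicToId φ ∧ moveCurves φ q.cuts = q'.cuts ∧
    moveCurves φ {q.c₁, q.c₂} = {q'.c₁, q'.c₂}
  iseqv :=
    { refl := fun q => ⟨_, .refl, moveCurves_refl _, moveCurves_refl _⟩
      symm := fun ⟨φ, h, h', h''⟩ => ⟨φ.symm, h.symm, moveCurves_symm h', moveCurves_symm h''⟩
      trans := fun ⟨φ, h, h', h''⟩ ⟨ψ, k, k', k''⟩ =>
        ⟨φ.trans ψ, h.trans k, by rw [moveCurves_trans, h', k'], by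
          rw [moveCurves_trans, h'', k'']⟩ }

/-- Cut systems up to isotopy. -/
abbrev Vertex : Type u := Quotient S.cutSetoid

/-- The moves which remove one cut, up to isotopy. -/
abbrev Edge : Type u := Quotient S.pointedSetoid

/-- The relations `F_{c₁} F_{c₂} = F_{c₂} F_{c₁}`, up to isotopy. -/
abbrev Cell : Type u := Quotient S.bipointedSetoid

/-- The class of a cut system. -/
def vertex (C : CutSystem M) : S.Vertex := Quotient.mk S.cutSetoid C

/-- The class of a move. -/
def edge (p : PointedCutSystem M) : S.Edge := Quotient.mk S.pointedSetoid p

/-- The move `C → C \ {c}` starts at `C`. -/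
def source : S.Edge → S.Vertex :=
  Quotient.lift (fun p => S.vertex p.before) fun _ _ ⟨φ, h, h', _⟩ =>
    Quotient.sound (s := S.cutSetoid) ⟨φ, h, h'⟩

/-- The move `C → C \ {c}` ends at `C \ {c}`. -/
def target : S.Edge → S.Vertex :=
  Quotient.lift (fun p => S.vertex p.after) fun _ _ ⟨φ, h, h', h''⟩ =>
    Quotient.sound (s := S.cutSetoid) ⟨φ, h, moveCurves_diff h' h''⟩

end ESurface

end Surface

/-! ### Two-dimensional complexes -/

/-- The combinatorial data of a two-dimensional CW complex with directed edges whose `2`-cells are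
squares: a square is attached along
```
  · --top--→ ·
  ↑          ↑
 left      right
  |          |
  · -bottom→ ·
```
-/
structure SquareComplex where
  V : Type u
  E : Type u
  F : Type u
  src : E → V
  tgt : E → V
  bottom : F → E
  top : F → E
  left : F → E
  right : F → E
  src_bottom : ∀ f, src (bottom f) = src (left f)
  tgt_bottom : ∀ f, tgt (bottom f) = src (right f)
  tgt_left : ∀ f, tgt (left f) = src (top f)
  tgt_right : ∀ f, tgt (right f) = tgt (top f)

namespace SquareComplex

variable (K : SquareComplex.{u})

/-- The disjoint union of the closed cells: points, intervals and squares. -/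
abbrev Cells : Type u := (Σ _ : K.V, Unit) ⊕ (Σ _ : K.E, I) ⊕ (Σ _ : K.F, I × I)

variable {K}

/-- The point of `K.Cells` given by a vertex. -/
def vertexPt (v : K.V) : K.Cells := .inl ⟨v, ()⟩

/-- A point on the closed interval of an edge, directed from `0` to `1`. -/
def edgePt (e : K.E) (t : I) : K.Cells := .inr (.inl ⟨e, t⟩)

/-- A point of a closed square. -/
def squarePt (f : K.F) (a b : I) : K.Cells := .inr (.inr ⟨f, (a, b)⟩)

/-- The attaching of the ends of the edges to vertices and of the sides of the squares to edges. -/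
inductive Glue : K.Cells → K.Cells → Prop
  | src (e : K.E) : Glue (edgePt e 0) (vertexPt (K.src e))
  | tgt (e : K.E) : Glue (edgePt e 1) (vertexPt (K.tgt e))
  | bottom (f : K.F) (t : I) : Glue (squarePt f t 0) (edgePt (K.bottom f) t)
  | top (f : K.F) (t : I) : Glue (squarePt f t 1) (edgePt (K.top f) t)
  | left (f : K.F) (t : I) : Glue (squarePt f 0 t) (edgePt (K.left f) t)
  | right (f : K.F) (t : I) : Glue (squarePt f 1 t) (edgePt (K.right f) t)

variable (K)

/-- The topological space of the complex, with the quotient (that is, weak) topology. -/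
def Realization : Type u := Quot (Glue (K := K))

instance : TopologicalSpace K.Realization :=
  inferInstanceAs (TopologicalSpace (Quot (Glue (K := K))))

end SquareComplex

/-! ### The complex of cut systems -/

/-- The complex `𝒞(Σ)`: the vertices are the cut systems, the edges are the moves `F_c : C → C \ {c}`
for removable cuts `c`, and there is one `2`-cell for each relation
`F_{c₁} F_{c₂} (C) = F_{c₂} F_{c₁} (C)`, all up to isotopy. For the parameterization of a `2`-cell one
of the two orders of `c₁`, `c₂` is chosen. -/
def cutComplex {M : Type u} [TopologicalSpace M] [ChartedSpace (EuclideanHalfSpace 2) M]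
    (S : ESurface M) : SquareComplex.{u} where
  V := S.Vertex
  E := S.Edge
  F := S.Cell
  src := S.source
  tgt := S.target
  bottom f := S.edge f.out.first₁
  right f := S.edge f.out.second₂
  left f := S.edge f.out.first₂
  top f := S.edge f.out.second₁
  src_bottom _ := rfl
  tgt_bottom _ := rfl
  tgt_left _ := rfl
  tgt_right f := by
    change S.vertex _ = S.vertex _
    congr 1
    simp only [PointedCutSystem.after, BipointedCutSystem.second₁, BipointedCutSystem.second₂,
      CutSystem.mk.injEq]
    exact _root_.sdiff_sdiff_comm

end CutComplex

end

/-! In genus `0` every curve system is a cut system: curves in a component of the complement that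
separate nothing there separate nothing in the whole surface (`genus_component_le`). Hence every cut
is removable, and each vertex descends to the empty cut system.

Two different edges leaving one vertex can be represented by removing two different cuts of one cut
system, so they are adjacent sides of a square (`IsDiamond`). Choose one descending edge at each
vertex other than the empty system; this gives a path class `d v` from each vertex to the empty
system. By induction on the number of cuts, `d` is compatible with every edge: the edge spans a
square with the chosen one, and the remaining two sides start lower.

To pass from edge paths to arbitrary paths without cellular approximation, call a family `h x` of
path classes from `x` to the base point parallel along `p : x → y` if `[p] · h y = h x`. A family
compatible with the edges extends over all cells (`exists_isFlat`) and is then locally parallel,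
because open stars contract cell by cell (`StarRule`). Local parallelism implies `[p] = h x · (h
y)⁻¹` for every path `p`, which is simple connectedness. -/

namespace CutComplex

/-! ### Flat families of path classes -/

section Flat

open Path.Homotopic.Quotient

variable {X : Type*} [TopologicalSpace X] {b : X}

/-- The family `h` of classes of paths to `b` is parallel along the path `p`. -/
def IsParallel (h : ∀ x : X, Path.Homotopic.Quotient x b) {x y : X} (p : Path x y) : Prop :=
  (mk p).trans (h y) = h x

variable {h : ∀ x : X, Path.Homotopic.Quotient x b}

/-- Only values are compared, so endpoints that agree merely propositionally cause no casts. -/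
theorem IsParallel.congr {x y x' y' : X} {p : Path x y} {p' : Path x' y'}
    (hp : IsParallel h p) (e : ∀ t, p t = p' t) : IsParallel h p' := by
  obtain rfl : x = x' := by simpa using e 0
  obtain rfl : y = y' := by simpa using e 1
  obtain rfl : p = p' := by ext t; exact e t
  exact hp

theorem IsParallel.refl (x : X) : IsParallel h (Path.refl x) := by
  simp [IsParallel]

theorem IsParallel.symm {x y : X} {p : Path x y} (hp : IsParallel h p) :
    IsParallel h p.symm := by
  unfold IsParallel at *
  rw [← hp, mk_symm]
  simp [← Path.Homotopic.Quotient.trans_assoc]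

theorem IsParallel.trans {x y z : X} {p : Path x y} {p' : Path y z} (hp : IsParallel h p)
    (hp' : IsParallel h p') : IsParallel h (p.trans p') := by
  unfold IsParallel at *
  rw [← hp, ← hp', mk_trans, Path.Homotopic.Quotient.trans_assoc]

theorem IsParallel.of_homotopic {x y : X} {p p' : Path x y} (hp : IsParallel h p)
    (e : p.Homotopic p') : IsParallel h p' := by
  unfold IsParallel at *
  rwa [← Path.Homotopic.Quotient.eq.2 e]

/-- A family which is locally parallel is parallel along all paths. -/
theorem IsParallel.of_local
    (hloc : ∀ x : X, ∃ U ∈ 𝓝 x, ∀ {y z : X} (p : Path y z), (∀ t, p t ∈ U) → IsParallel h p)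
    {x y : X} (p : Path x y) : IsParallel h p := by
  have key : IsParallel h (p.subpath 0 1) := by
    -- The relation "parallel between times `s` and `t`" is transitive, and by compactness of `I`
    -- the subpath from `s` to a nearby `t` stays in `U`; connectedness of `I` does the rest.
    refine PreconnectedSpace.induction₂' (fun s t => IsParallel h (p.subpath s t)) (fun s => ?_)
      ?_ 0 1
    · obtain ⟨U, hU, hp⟩ := hloc (p s)
      have hc : Continuous fun q : I × I => p.subpath s q.1 q.2 :=
        p.subpath_continuous_family.comp (by fun_prop : Continuous fun q : I × I => (s, q.1, q.2))
      have : ∀ᶠ t in 𝓝 s, ∀ r ∈ (univ : Set I), p.subpath s t r ∈ U := by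
        refine isCompact_univ.eventually_forall_of_forall_eventually fun r _ => ?_
        exact hc.continuousAt.preimage_mem_nhds (by simpa using hU)
      filter_upwards [this] with t ht
      have h1 := hp (p.subpath s t) fun r => ht r trivial
      exact ⟨h1, by simpa using h1.symm⟩
    · exact ⟨fun r s t h₁ h₂ =>
        (h₁.trans h₂).of_homotopic ⟨Path.Homotopy.subpathTransSubpath p r s t⟩⟩
  exact key.congr fun t => by simp

/-- The class of `p` equals `h x · (h y)⁻¹`, which depends on the endpoints only. -/
theorem simplyConnectedSpace_of_isParallel
    (hp : ∀ {x y : X} (p : Path x y), IsParallel h p) : SimplyConnectedSpace X := by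
  rw [simply_connected_iff_paths_homotopic']
  refine ⟨⟨⟨b⟩, fun x y => ?_⟩, fun {x y} p p' => ?_⟩
  · exact ⟨(h x).out.trans (h y).out.symm⟩
  · rw [← Path.Homotopic.Quotient.eq]
    have e : (mk p).trans (h y) = (mk p').trans (h y) := Eq.trans (hp p) (Eq.symm (hp p'))
    have := congrArg (fun c => c.trans (h y).symm) e
    simpa [Path.Homotopic.Quotient.trans_assoc] using this

/-! ### Flatness over simply connected parameter spaces -/

variable {D D' : Type*} [TopologicalSpace D] [TopologicalSpace D']

/-- The family `h` is parallel along the image of paths from `u` to `v`. -/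
def IsFlat (h : ∀ x : X, Path.Homotopic.Quotient x b) (g : C(D, X)) (u v : D) : Prop :=
  ∀ p : Path u v, IsParallel h (p.map g.continuous)

theorem IsFlat.symm {g : C(D, X)} {u v : D} (huv : IsFlat h g u v) : IsFlat h g v u :=
  fun p => (huv p.symm).symm.congr fun t => by simp

theorem IsFlat.comp {g : C(D, X)} {k : C(D', D)} {u v : D'} (huv : IsFlat h g (k u) (k v)) :
    IsFlat h (g.comp k) u v := fun p => huv (p.map k.continuous)

variable [SimplyConnectedSpace D] [SimplyConnectedSpace D']

/-- All paths from `u` to `v` in `D` are homotopic, so testing one suffices. -/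
theorem IsFlat.of_path {g : C(D, X)} {u v : D} {p : Path u v}
    (hp : IsParallel h (p.map g.continuous)) : IsFlat h g u v := fun p' =>
  hp.of_homotopic ((SimplyConnectedSpace.paths_homotopic p p').map g)

theorem IsFlat.refl (g : C(D, X)) (u : D) : IsFlat h g u u :=
  IsFlat.of_path (p := Path.refl u) ((IsParallel.refl (g u)).congr fun _ => rfl)

theorem IsFlat.trans {g : C(D, X)} {u v w : D} (huv : IsFlat h g u v) (hvw : IsFlat h g v w) :
    IsFlat h g u w := by
  have p := PathConnectedSpace.somePath u v
  have p' := PathConnectedSpace.somePath v w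
  refine IsFlat.of_path (p := p.trans p') ?_
  rw [Path.map_trans]
  exact (huv p).trans (hvw p')

theorem IsFlat.of_comp {g : C(D, X)} {k : C(D', D)} {u v : D'} (huv : IsFlat h (g.comp k) u v) :
    IsFlat h g (k u) (k v) :=
  IsFlat.of_path (p := (PathConnectedSpace.somePath u v).map k.continuous) (huv _)

/-- The value at `u` of the family obtained by moving `h (g w)` along `g`. -/
noncomputable def flatValue (h : ∀ x : X, Path.Homotopic.Quotient x b) (g : C(D, X)) (w u : D) :
    Path.Homotopic.Quotient (g u) b :=
  (mk ((PathConnectedSpace.somePath u w).map g.continuous)).trans (h (g w))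

/-- The choice of path in `flatValue` is immaterial, so the transported family is parallel along
every path of `D`. -/
theorem mk_trans_flatValue (g : C(D, X)) (w : D) {u v : D} (p : Path u v) :
    (mk (p.map g.continuous)).trans (flatValue h g w v) = flatValue h g w u := by
  rw [flatValue, flatValue, ← Path.Homotopic.Quotient.trans_assoc, ← mk_trans, ← Path.map_trans]
  congr 1
  exact Path.Homotopic.Quotient.eq.2 ((SimplyConnectedSpace.paths_homotopic _ _).map g)

theorem flatValue_self (g : C(D, X)) (w : D) : flatValue h g w w = h (g w) := by
  have : (PathConnectedSpace.somePath w w).Homotopic (Path.refl w) :=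
    SimplyConnectedSpace.paths_homotopic _ _
  rw [flatValue, Path.Homotopic.Quotient.eq.2 (this.map g)]
  exact IsParallel.refl (h := h) (g w)

theorem IsFlat.flatValue_eq {g : C(D, X)} {w w' : D} (hw : IsFlat h g w w') (u : D) :
    flatValue h g w u = flatValue h g w' u := by
  rw [← mk_trans_flatValue g w (PathConnectedSpace.somePath u w), flatValue_self,
    ← hw (PathConnectedSpace.somePath w w'), ← Path.Homotopic.Quotient.trans_assoc, ← mk_trans,
    ← Path.map_trans, ← flatValue_self (h := h) g w', mk_trans_flatValue]

theorem flatValue_comp (g : C(D, X)) (k : C(D', D)) (w u : D') :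
    flatValue h (g.comp k) w u = flatValue h g (k w) (k u) := by
  rw [← mk_trans_flatValue g (k w) ((PathConnectedSpace.somePath u w).map k.continuous),
    flatValue_self]
  rfl

/-- Matches the values on a square with those on a side. The sigma type absorbs the merely
propositional equality of the points `g (k u)` and `g' u`. -/
theorem sigma_flatValue_comp {g : C(D, X)} {k : C(D', D)} {g' : C(D', X)}
    (hg : g.comp k = g') {w : D} {w' : D'} (hw : IsFlat h g (k w') w) (u : D') :
    (⟨g (k u), flatValue h g w (k u)⟩ : Σ x : X, Path.Homotopic.Quotient x b) =
      ⟨g' u, flatValue h g' w' u⟩ := by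
  subst hg
  rw [flatValue_comp, hw.flatValue_eq]
  rfl

end Flat

instance : ContractibleSpace I :=
  (convex_Icc (0 : ℝ) 1).contractibleSpace ⟨0, by simp⟩

namespace SquareComplex

universe u

variable {K : SquareComplex.{u}}

/-! ### Characteristic maps of the cells -/

/-- The quotient map from the closed cells to the complex. -/
def proj (z : K.Cells) : K.Realization := Quot.mk _ z

theorem isQuotientMap_proj : IsQuotientMap (proj : K.Cells → K.Realization) :=
  isQuotientMap_quot_mk

theorem proj_eq {z z' : K.Cells} (hz : Glue z z') : proj z = proj z' := Quot.sound hz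

theorem continuous_edgePt (e : K.E) : Continuous (edgePt e : I → K.Cells) :=
  continuous_inr.comp (continuous_inl.comp continuous_sigmaMk)

theorem continuous_squarePt (f : K.F) : Continuous fun p : I × I => squarePt f p.1 p.2 :=
  continuous_inr.comp (continuous_inr.comp
    (continuous_sigmaMk : Continuous (Sigma.mk (β := fun _ : K.F => I × I) f)))

/-- The point of the complex given by a vertex. -/
def vertexMap (v : K.V) : K.Realization := proj (vertexPt v)

/-- The characteristic map of an edge. -/
def edgeMap (e : K.E) : C(I, K.Realization) :=
  ⟨fun t => proj (edgePt e t), isQuotientMap_proj.continuous.comp (continuous_edgePt e)⟩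

/-- The characteristic map of a square. -/
def squareMap (f : K.F) : C(I × I, K.Realization) :=
  ⟨fun p => proj (squarePt f p.1 p.2), isQuotientMap_proj.continuous.comp (continuous_squarePt f)⟩

/-- The horizontal line at height `s` in the square. -/
def horizontal (s : I) : C(I, I × I) := ⟨fun t => (t, s), by fun_prop⟩

/-- The vertical line over `s` in the square. -/
def vertical (s : I) : C(I, I × I) := ⟨fun t => (s, t), by fun_prop⟩

theorem edgeMap_zero (e : K.E) : edgeMap e 0 = vertexMap (K.src e) := proj_eq (.src e)

theorem edgeMap_one (e : K.E) : edgeMap e 1 = vertexMap (K.tgt e) := proj_eq (.tgt e)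

theorem squareMap_bottom (f : K.F) : (squareMap f).comp (horizontal 0) = edgeMap (K.bottom f) :=
  ContinuousMap.ext fun t => proj_eq (.bottom f t)

theorem squareMap_top (f : K.F) : (squareMap f).comp (horizontal 1) = edgeMap (K.top f) :=
  ContinuousMap.ext fun t => proj_eq (.top f t)

theorem squareMap_left (f : K.F) : (squareMap f).comp (vertical 0) = edgeMap (K.left f) :=
  ContinuousMap.ext fun t => proj_eq (.left f t)

theorem squareMap_right (f : K.F) : (squareMap f).comp (vertical 1) = edgeMap (K.right f) :=
  ContinuousMap.ext fun t => proj_eq (.right f t)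

/-- The vertex at a point of an edge, if there is one. -/
noncomputable def vertexOfEdge (e : K.E) (t : I) : Option K.V :=
  if t = 0 then some (K.src e) else if t = 1 then some (K.tgt e) else none

/-- The vertex at a point of a cell, if there is one. -/
noncomputable def vertexOfCells : K.Cells → Option K.V
  | .inl v => some v.1
  | .inr (.inl p) => vertexOfEdge p.1 p.2
  | .inr (.inr p) =>
    if p.2.2 = 0 then vertexOfEdge (K.bottom p.1) p.2.1
    else if p.2.2 = 1 then vertexOfEdge (K.top p.1) p.2.1 else none

theorem vertexOfCells_eq {z z' : K.Cells} (hz : Glue z z') :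
    vertexOfCells z = vertexOfCells z' := by
  have h10 : (1 : I) ≠ 0 := one_ne_zero
  cases hz with
  | src e => simp [vertexOfCells, edgePt, vertexPt, vertexOfEdge]
  | tgt e => simp [vertexOfCells, edgePt, vertexPt, vertexOfEdge]
  | bottom f t => simp [vertexOfCells, edgePt, squarePt]
  | top f t => simp [vertexOfCells, edgePt, squarePt]
  | left f t =>
    simp only [vertexOfCells, edgePt, squarePt, vertexOfEdge]
    split_ifs <;> simp_all [K.src_bottom, K.tgt_left]
  | right f t =>
    simp only [vertexOfCells, edgePt, squarePt, vertexOfEdge]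
    split_ifs <;> simp_all [K.tgt_bottom, K.tgt_right]

/-- `vertexOfCells` respects the gluing and descends to a left inverse. -/
theorem vertexMap_injective : Function.Injective (vertexMap : K.V → K.Realization) := by
  intro v w hvw
  have := congrArg (Quot.lift vertexOfCells fun _ _ => vertexOfCells_eq) hvw
  exact Option.some_injective _ this

/-! ### Extending flat families from the edges to the complex -/

section Extend

variable {b : K.Realization} {h : ∀ x : K.Realization, Path.Homotopic.Quotient x b}

/-- The extension to the closed cells of a family of path classes at the vertices. -/
noncomputable def cellsValue (h : ∀ x : K.Realization, Path.Homotopic.Quotient x b) :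
    ∀ z : K.Cells, Path.Homotopic.Quotient (proj z) b
  | .inl v => h (vertexMap v.1)
  | .inr (.inl p) => flatValue h (edgeMap p.1) 1 p.2
  | .inr (.inr p) => flatValue h (squareMap p.1) (1, 1) p.2

theorem isFlat_side {f : K.F} {e : K.E} {k : C(I, I × I)} (hk : (squareMap f).comp k = edgeMap e)
    (he : IsFlat h (edgeMap e) 0 1) : IsFlat h (squareMap f) (k 0) (k 1) :=
  IsFlat.of_comp (hk ▸ he)

/-- Edges are anchored at their target, squares at `(1, 1)`. The top and right sides end at `(1,
1)`; the ends of the bottom and left sides reach it along the flat right and top sides. -/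
theorem cellsValue_eq (he : ∀ e, IsFlat h (edgeMap e) 0 1) {z z' : K.Cells} (hz : Glue z z') :
    (⟨proj z, cellsValue h z⟩ : Σ x : K.Realization, Path.Homotopic.Quotient x b) =
      ⟨proj z', cellsValue h z'⟩ := by
  cases hz with
  | src e =>
    change (⟨edgeMap e 0, flatValue h (edgeMap e) 1 0⟩ :
      Σ x : K.Realization, Path.Homotopic.Quotient x b) = ⟨vertexMap _, h (vertexMap _)⟩
    rw [← (he e).flatValue_eq, flatValue_self, edgeMap_zero]
  | tgt e =>
    change (⟨edgeMap e 1, flatValue h (edgeMap e) 1 1⟩ :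
      Σ x : K.Realization, Path.Homotopic.Quotient x b) = ⟨vertexMap _, h (vertexMap _)⟩
    rw [flatValue_self, edgeMap_one]
  | bottom f t =>
    have hf : IsFlat h (squareMap f) (1, 0) (1, 1) := isFlat_side (squareMap_right f) (he _)
    exact sigma_flatValue_comp (squareMap_bottom f) hf t
  | top f t => exact sigma_flatValue_comp (squareMap_top f) (IsFlat.refl _ _) t
  | left f t =>
    have hf : IsFlat h (squareMap f) (0, 1) (1, 1) := isFlat_side (squareMap_top f) (he _)
    exact sigma_flatValue_comp (squareMap_left f) hf t
  | right f t => exact sigma_flatValue_comp (squareMap_right f) (IsFlat.refl _ _) t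

/-- A family of path classes which is flat along the edges can be changed away from the vertices
into one which is flat along all cells. -/
theorem exists_isFlat (he : ∀ e, IsFlat h (edgeMap e) 0 1) :
    ∃ h' : ∀ x : K.Realization, Path.Homotopic.Quotient x b,
      (∀ e u v, IsFlat h' (edgeMap e) u v) ∧ ∀ f u v, IsFlat h' (squareMap f) u v := by
  -- The type of the value depends on the point, so the lift goes to the total space. On `proj z`
  -- the transport along `h1` is definitionally trivial.
  let hT : K.Realization → Σ x : K.Realization, Path.Homotopic.Quotient x b :=
    Quot.lift (fun z => ⟨proj z, cellsValue h z⟩) fun _ _ => cellsValue_eq he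
  have h1 : ∀ x, (hT x).1 = x := by
    rintro ⟨z⟩
    rfl
  refine ⟨fun x => (h1 x) ▸ (hT x).2, fun e u v p => ?_, fun f u v p => ?_⟩
  · exact mk_trans_flatValue (edgeMap e) 1 p
  · exact mk_trans_flatValue (squareMap f) (1, 1) p

end Extend

/-! ### Stars and their contractions -/

/-- A rule which selects an open part of the point, the interval and the square, and moves each
point of it along a straight line to a centre that depends on the point in a locally constant way.
The parts and the centres match along the sides. -/
structure StarRule where
  onV : Prop
  onE : Set I
  onF : Set (I × I)
  centerE : I → I
  centerF : I × I → I × I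
  isOpen_onE : IsOpen onE
  isOpen_onF : IsOpen onF
  eventually_centerE : ∀ t ∈ onE, ∀ᶠ s in 𝓝 t, centerE s = centerE t
  eventually_centerF : ∀ p ∈ onF, ∀ᶠ q in 𝓝 p, centerF q = centerF p
  zero_mem : 0 ∈ onE ↔ onV
  one_mem : 1 ∈ onE ↔ onV
  center_zero : onV → centerE 0 = 0
  center_one : onV → centerE 1 = 1
  horizontal_mem : ∀ s : I, s = 0 ∨ s = 1 → ∀ t, (t, s) ∈ onF ↔ t ∈ onE
  vertical_mem : ∀ s : I, s = 0 ∨ s = 1 → ∀ t, (s, t) ∈ onF ↔ t ∈ onE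
  center_horizontal : ∀ s : I, s = 0 ∨ s = 1 → ∀ t ∈ onE, centerF (t, s) = (centerE t, s)
  center_vertical : ∀ s : I, s = 0 ∨ s = 1 → ∀ t ∈ onE, centerF (s, t) = (s, centerE t)

namespace StarRule

variable (r : StarRule) {K : SquareComplex.{u}}

/-- The selected part of the closed cells. -/
def onCells : K.Cells → Prop
  | .inl _ => r.onV
  | .inr (.inl p) => p.2 ∈ r.onE
  | .inr (.inr p) => p.2 ∈ r.onF

/-- The position at time `s` of a point which moves to its centre. -/
noncomputable def slide (s : I) : K.Cells → K.Cells
  | .inl v => .inl v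
  | .inr (.inl p) => edgePt p.1 (Icc.convexComb p.2 (r.centerE p.2) s)
  | .inr (.inr p) => squarePt p.1 (Icc.convexComb p.2.1 (r.centerF p.2).1 s)
      (Icc.convexComb p.2.2 (r.centerF p.2).2 s)

variable {r}

theorem onCells_iff {z z' : K.Cells} (hz : Glue z z') : r.onCells z ↔ r.onCells z' := by
  cases hz with
  | src e => exact r.zero_mem
  | tgt e => exact r.one_mem
  | bottom f t => exact r.horizontal_mem 0 (.inl rfl) t
  | top f t => exact r.horizontal_mem 1 (.inr rfl) t
  | left f t => exact r.vertical_mem 0 (.inl rfl) t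
  | right f t => exact r.vertical_mem 1 (.inr rfl) t

theorem convexComb_self (a s : I) : Icc.convexComb a a s = a := by simp

/-- The centre of a point on a side lies on the same side, at the centre prescribed by the edge, so
sliding is compatible with gluing. -/
theorem proj_slide_eq {z z' : K.Cells} (hz : Glue z z') (hr : r.onCells z) (s : I) :
    proj (r.slide s z) = proj (r.slide s z') := by
  have hr' := (onCells_iff hz).1 hr
  cases hz with
  | src e =>
    simp only [slide, edgePt, vertexPt, r.center_zero hr', convexComb_self]
    exact proj_eq (.src e)
  | tgt e =>
    simp only [slide, edgePt, vertexPt, r.center_one hr', convexComb_self]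
    exact proj_eq (.tgt e)
  | bottom f t =>
    simp only [slide, edgePt, squarePt, r.center_horizontal 0 (.inl rfl) t hr', convexComb_self]
    exact proj_eq (.bottom f _)
  | top f t =>
    simp only [slide, edgePt, squarePt, r.center_horizontal 1 (.inr rfl) t hr', convexComb_self]
    exact proj_eq (.top f _)
  | left f t =>
    simp only [slide, edgePt, squarePt, r.center_vertical 0 (.inl rfl) t hr', convexComb_self]
    exact proj_eq (.left f _)
  | right f t =>
    simp only [slide, edgePt, squarePt, r.center_vertical 1 (.inr rfl) t hr', convexComb_self]
    exact proj_eq (.right f _)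

theorem slide_zero (z : K.Cells) : r.slide 0 z = z := by
  rcases z with v | ⟨e, t⟩ | ⟨f, p⟩ <;> simp [slide, edgePt, squarePt]

theorem isOpen_onCells : IsOpen {z : K.Cells | r.onCells z} := by
  simp only [isOpen_sum_iff, isOpen_sigma_iff]
  refine ⟨fun v => ?_, fun e => r.isOpen_onE, fun f => r.isOpen_onF⟩
  exact isOpen_discrete _

theorem isOpenEmbedding_vertexPt (v : K.V) :
    IsOpenEmbedding (fun _ : Unit => (vertexPt v : K.Cells)) :=
  IsOpenEmbedding.inl.comp
    (.sigmaMk : IsOpenEmbedding (Sigma.mk (β := fun _ : K.V => Unit) v))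

theorem isOpenEmbedding_edgePt (e : K.E) : IsOpenEmbedding (edgePt e : I → K.Cells) :=
  IsOpenEmbedding.inr.comp (IsOpenEmbedding.inl.comp
    (.sigmaMk : IsOpenEmbedding (Sigma.mk (β := fun _ : K.E => I) e)))

theorem isOpenEmbedding_squarePt (f : K.F) :
    IsOpenEmbedding (fun p : I × I => (squarePt f p.1 p.2 : K.Cells)) :=
  IsOpenEmbedding.inr.comp
    (IsOpenEmbedding.inr.comp
    (.sigmaMk : IsOpenEmbedding (Sigma.mk (β := fun _ : K.F => I × I) f)))

theorem continuous_convexComb_left (c : I) :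
    Continuous fun p : I × I => Icc.convexComb p.1 c p.2 :=
  Icc.continuous_convexComb_prod.comp (by fun_prop : Continuous fun p : I × I => (p.1, c, p.2))

/-- Near `z` the centre is constant, so the slide is a convex combination with a fixed end. -/
theorem continuousAt_slide {z : K.Cells} (hz : r.onCells z) (s : I) :
    ContinuousAt (fun p : K.Cells × I => r.slide p.2 p.1) (z, s) := by
  rcases z with ⟨v, u⟩ | ⟨e, t⟩ | ⟨f, p⟩
  · refine (((isOpenEmbedding_vertexPt v).prodMap .id).continuousAt_iff (x := (u, s))).1 ?_
    exact continuousAt_const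
  · refine (((isOpenEmbedding_edgePt e).prodMap .id).continuousAt_iff (x := (t, s))).1 ?_
    have hc : Continuous fun p : I × I =>
        (edgePt e (Icc.convexComb p.1 (r.centerE t) p.2) : K.Cells) :=
      (continuous_edgePt e).comp (continuous_convexComb_left _)
    refine hc.continuousAt.congr ?_
    filter_upwards [continuousAt_fst.eventually (r.eventually_centerE t hz)] with p hp
    simp only [Function.comp, Prod.map, slide, edgePt, hp, id]
  · refine (((isOpenEmbedding_squarePt f).prodMap .id).continuousAt_iff (x := (p, s))).1 ?_
    have hc : Continuous fun q : (I × I) × I =>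
        (squarePt f (Icc.convexComb q.1.1 (r.centerF p).1 q.2)
          (Icc.convexComb q.1.2 (r.centerF p).2 q.2) : K.Cells) :=
      (continuous_squarePt f).comp (.prodMk
        ((continuous_convexComb_left _).comp
          (by fun_prop : Continuous fun q : (I × I) × I => (q.1.1, q.2)))
        ((continuous_convexComb_left _).comp
          (by fun_prop : Continuous fun q : (I × I) × I => (q.1.2, q.2))))
    refine hc.continuousAt.congr ?_
    filter_upwards [continuousAt_fst.eventually (r.eventually_centerF p hz)] with q hq
    simp only [Function.comp, Prod.map, slide, squarePt, hq, id]

theorem eventually_proj_slide_one {z : K.Cells} (hz : r.onCells z) :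
    ∀ᶠ z' in 𝓝 z, proj (r.slide 1 z') = proj (r.slide 1 z) := by
  rcases z with ⟨v, u⟩ | ⟨e, t⟩ | ⟨f, p⟩
  · change ∀ᶠ z' in 𝓝 (vertexPt v), _
    rw [← (isOpenEmbedding_vertexPt v).map_nhds_eq u, Filter.eventually_map]
    exact .of_forall fun _ => rfl
  · change ∀ᶠ z' in 𝓝 (edgePt e t), _
    rw [← (isOpenEmbedding_edgePt e).map_nhds_eq t, Filter.eventually_map]
    filter_upwards [r.eventually_centerE t hz] with t' ht'
    simp [slide, edgePt, ht']
  · change ∀ᶠ z' in 𝓝 (squarePt f p.1 p.2), _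
    rw [← (isOpenEmbedding_squarePt f).map_nhds_eq p, Filter.eventually_map]
    filter_upwards [r.eventually_centerF p hz] with p' hp'
    simp [slide, squarePt, hp']

variable (r)

/-- The selected part of the complex. -/
def star : Set K.Realization :=
  {x | Quot.lift (r.onCells : K.Cells → Prop) (fun _ _ hz => propext (onCells_iff hz)) x}

open Classical in
/-- The contraction of the selected part of the complex. -/
noncomputable def flow (s : I) : K.Realization → K.Realization :=
  Quot.lift (fun z => if r.onCells z then proj (r.slide s z) else proj z) fun z z' hz => by
    by_cases hr : r.onCells z
    · simp only [if_pos hr, if_pos ((onCells_iff hz).1 hr), proj_slide_eq hz hr]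
    · simp only [if_neg hr, if_neg (fun h => hr ((onCells_iff hz).2 h)), proj_eq hz]

variable {r}

theorem flow_proj {z : K.Cells} (hz : r.onCells z) (s : I) :
    r.flow s (proj z) = proj (r.slide s z) :=
  if_pos hz

theorem isOpen_star : IsOpen (r.star : Set K.Realization) :=
  isQuotientMap_proj.isOpen_preimage.1 isOpen_onCells

/-- The quotient map restricted to an open saturated set is again a quotient map, and remains one
after taking the product with the locally compact `I`. -/
theorem continuous_flow :
    Continuous fun p : ↥(r.star : Set K.Realization) × I => r.flow p.2 (p.1 : K.Realization) := by
  have hq := (isQuotientMap_proj (K := K)).restrictPreimage_isOpen (isOpen_star (r := r))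
  refine hq.continuous_lift_prod_left
    (g := fun p : ↥(r.star : Set K.Realization) × I => r.flow p.2 (p.1 : K.Realization)) ?_
  have : ∀ p : (proj ⁻¹' (r.star : Set K.Realization)) × I,
      r.flow p.2 (proj p.1.1) = proj (r.slide p.2 p.1.1) := fun p => flow_proj p.1.2 p.2
  simp only [restrictPreimage_coe, this]
  refine isQuotientMap_proj.continuous.comp (continuous_iff_continuousAt.2 fun p => ?_)
  exact ContinuousAt.comp (f := fun p : (proj ⁻¹' (r.star : Set K.Realization)) × I =>
    ((p.1 : K.Cells), p.2)) (continuousAt_slide p.1.2 p.2) (by fun_prop)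

theorem eventually_flow_one {x : K.Realization} (hx : x ∈ r.star) :
    {y | y ∈ r.star ∧ r.flow 1 y = r.flow 1 x} ∈ 𝓝 x := by
  refine IsOpen.mem_nhds ?_ ⟨hx, rfl⟩
  refine isQuotientMap_proj.isOpen_preimage.1 (isOpen_iff_mem_nhds.2 fun z hz => ?_)
  obtain ⟨h1, h2⟩ := hz
  filter_upwards [isOpen_onCells.mem_nhds h1, eventually_proj_slide_one h1] with z' h3 h4
  refine ⟨h3, ?_⟩
  rw [← h2, flow_proj h3, flow_proj h1, h4]

variable {b : K.Realization} {h : ∀ x : K.Realization, Path.Homotopic.Quotient x b}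

/-- The track of a point under the contraction. -/
noncomputable def track (r : StarRule) (x : K.Realization) (hx : x ∈ r.star) :
    C(I, K.Realization) :=
  ⟨fun s => r.flow s x, (continuous_flow (r := r)).comp
    (by fun_prop : Continuous fun s : I => ((⟨x, hx⟩ : (r.star : Set K.Realization)), s))⟩

/-- A track never leaves the closed cell it starts in. -/
theorem isFlat_track (hE : ∀ e u v, IsFlat h (edgeMap e) u v)
    (hF : ∀ f u v, IsFlat h (squareMap f) u v) (x : K.Realization) (hx : x ∈ r.star) :
    IsFlat h (track r x hx) 0 1 := by
  obtain ⟨z, rfl⟩ := isQuotientMap_proj.surjective x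
  have hz : r.onCells z := hx
  have ht : ∀ s, track r (proj z) hx s = proj (r.slide s z) := fun s => flow_proj hz s
  rcases z with ⟨v, u⟩ | ⟨e, t⟩ | ⟨f, p⟩
  · refine fun p => (IsParallel.refl (vertexMap v)).congr fun s => ?_
    rw [Path.map_coe, Function.comp_apply, ht]
    rfl
  · let k : C(I, I) := ⟨fun s => Icc.convexComb t (r.centerE t) s, by fun_prop⟩
    have : track r _ hx = (edgeMap e).comp k := ContinuousMap.ext ht
    rw [this]
    exact (hE e _ _).comp
  · let k : C(I, I × I) := ⟨fun s => (Icc.convexComb p.1 (r.centerF p).1 s,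
      Icc.convexComb p.2 (r.centerF p).2 s), by fun_prop⟩
    have : track r _ hx = (squareMap f).comp k := ContinuousMap.ext ht
    rw [this]
    exact (hF f _ _).comp

theorem flow_zero {x : K.Realization} (hx : x ∈ r.star) : r.flow 0 x = x := by
  obtain ⟨z, rfl⟩ := isQuotientMap_proj.surjective x
  rw [flow_proj hx, slide_zero]

/-- A family which is flat along the cells is parallel along small paths in a star. -/
theorem isParallel_of_mem_star (hE : ∀ e u v, IsFlat h (edgeMap e) u v)
    (hF : ∀ f u v, IsFlat h (squareMap f) u v) {c x y : K.Realization} (p : Path x y)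
    (hp : ∀ t, p t ∈ r.star ∧ r.flow 1 (p t) = c) : IsParallel h p := by
  -- The first coordinate is the parameter of `p`, the second the time of the flow. Two sides of
  -- this square are flat tracks and the side at time `1` is constant at `c`, so the side at time
  -- `0`, which is `p`, is parallel.
  let G : C(I × I, K.Realization) := ⟨fun q => r.flow q.2 (p q.1), (continuous_flow (r := r)).comp
    (by fun_prop : Continuous fun q : I × I =>
      ((⟨p q.1, (hp q.1).1⟩ : (r.star : Set K.Realization)), q.2))⟩
  have hv : ∀ s, IsFlat h G (s, 0) (s, 1) := fun s =>
    IsFlat.of_comp (k := vertical s) (isFlat_track hE hF (p s) (hp s).1)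
  have ht : IsFlat h G (0, 1) (1, 1) := by
    refine IsFlat.of_comp (k := horizontal 1) (u := (0 : I)) (v := 1) fun q => ?_
    exact (IsParallel.refl c).congr fun t => ((hp (q t)).2).symm
  have hb : IsFlat h G (0, 0) (1, 0) := ((hv 0).trans ht).trans (hv 1).symm
  let q : Path ((0, 0) : I × I) (1, 0) := ⟨horizontal 0, rfl, rfl⟩
  exact (hb q).congr fun t => flow_zero (hp t).1

end StarRule

/-! ### Three kinds of stars that cover the complex -/

namespace StarRule

/-- The nearest end of the interval. -/
noncomputable def nearestEnd (t : I) : I := if (t : ℝ) < 1 / 2 then 0 else 1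

theorem eventually_nearestEnd {t : I} (ht : (t : ℝ) ≠ 1 / 2) :
    ∀ᶠ s in 𝓝 t, nearestEnd s = nearestEnd t := by
  have hc : ContinuousAt (fun s : I => (s : ℝ)) t := by fun_prop
  rcases lt_or_gt_of_ne ht with ht | ht
  · filter_upwards [hc.eventually_lt continuousAt_const ht] with s hs
    simp only [nearestEnd, if_pos hs, if_pos ht]
  · filter_upwards [continuousAt_const.eventually_lt hc ht] with s hs
    simp only [nearestEnd, if_neg hs.not_gt, if_neg ht.not_gt]

theorem nearestEnd_zero : nearestEnd 0 = 0 := by norm_num [nearestEnd]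

theorem nearestEnd_one : nearestEnd 1 = 1 := by norm_num [nearestEnd]

theorem coe_end_ne_half {s : I} (hs : s = 0 ∨ s = 1) : (s : ℝ) ≠ 1 / 2 := by
  rcases hs with rfl | rfl <;> norm_num

theorem nearestEnd_end {s : I} (hs : s = 0 ∨ s = 1) : nearestEnd s = s := by
  rcases hs with rfl | rfl
  · exact nearestEnd_zero
  · exact nearestEnd_one

/-- The stars of the vertices. -/
noncomputable def vertexStars : StarRule where
  onV := True
  onE := {t | (t : ℝ) ≠ 1 / 2}
  onF := {p | (p.1 : ℝ) ≠ 1 / 2 ∧ (p.2 : ℝ) ≠ 1 / 2}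
  centerE := nearestEnd
  centerF p := (nearestEnd p.1, nearestEnd p.2)
  isOpen_onE := isOpen_ne_fun (by fun_prop) (by fun_prop)
  isOpen_onF := (isOpen_ne_fun (by fun_prop) (by fun_prop)).inter
    (isOpen_ne_fun (by fun_prop) (by fun_prop))
  eventually_centerE _ ht := eventually_nearestEnd ht
  eventually_centerF p hp := by
    filter_upwards [continuousAt_fst.eventually (eventually_nearestEnd hp.1),
      continuousAt_snd.eventually (eventually_nearestEnd hp.2)] with q h1 h2
    rw [h1, h2]
  zero_mem := by norm_num
  one_mem := by norm_num
  center_zero _ := nearestEnd_zero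
  center_one _ := nearestEnd_one
  horizontal_mem s hs t := and_iff_left (coe_end_ne_half hs)
  vertical_mem s hs t := and_iff_right (coe_end_ne_half hs)
  center_horizontal s hs t _ := by simp [nearestEnd_end hs]
  center_vertical s hs t _ := by simp [nearestEnd_end hs]

/-- The midpoint of the interval. -/
noncomputable def half : I := ⟨1 / 2, by norm_num, by norm_num⟩

/-- The midpoint of the nearest side of the square. -/
noncomputable def nearestMidpoint (p : I × I) : I × I :=
  if (p.2 : ℝ) < p.1 then if (p.1 + p.2 : ℝ) < 1 then (half, 0) else (1, half)
  else if (p.1 + p.2 : ℝ) < 1 then (0, half) else (half, 1)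

theorem eventually_lt_iff {X : Type*} [TopologicalSpace X] {f g : X → ℝ} {x : X}
    (hf : Continuous f) (hg : Continuous g) (h : f x ≠ g x) :
    ∀ᶠ y in 𝓝 x, (f y < g y ↔ f x < g x) := by
  rcases lt_or_gt_of_ne h with h | h
  · filter_upwards [hf.continuousAt.eventually_lt hg.continuousAt h] with y hy
    exact iff_of_true hy h
  · filter_upwards [hg.continuousAt.eventually_lt hf.continuousAt h] with y hy
    exact iff_of_false hy.not_gt h.not_gt

/-- The stars of the midpoints of the edges. -/
noncomputable def edgeStars : StarRule where
  onV := False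
  onE := {t | (0 : ℝ) < t ∧ (t : ℝ) < 1}
  -- Without its diagonals the square falls into four triangles, each based on one side and slid to
  -- the midpoint of that side.
  onF := {p | (p.2 : ℝ) ≠ p.1 ∧ (p.1 + p.2 : ℝ) ≠ 1}
  centerE _ := half
  centerF := nearestMidpoint
  isOpen_onE := .and (isOpen_lt (by fun_prop) (by fun_prop))
    (isOpen_lt (by fun_prop) (by fun_prop))
  isOpen_onF := (isOpen_ne_fun (by fun_prop) (by fun_prop)).inter
    (isOpen_ne_fun (by fun_prop) (by fun_prop))
  eventually_centerE _ _ := .of_forall fun _ => rfl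
  eventually_centerF p hp := by
    filter_upwards [eventually_lt_iff (f := fun q : I × I => (q.2 : ℝ))
      (g := fun q : I × I => (q.1 : ℝ)) (by fun_prop) (by fun_prop) hp.1,
      eventually_lt_iff (f := fun q : I × I => (q.1 + q.2 : ℝ)) (g := fun q : I × I => (1 : ℝ))
      (by fun_prop) (by fun_prop) hp.2] with q h1 h2
    simp only [nearestMidpoint, h1, h2]
  zero_mem := by simp
  one_mem := by simp
  center_zero h := h.elim
  center_one h := h.elim
  horizontal_mem s hs t := by
    have h0 := t.2.1
    have h1 := t.2.2
    rcases hs with rfl | rfl <;> simp [lt_iff_le_and_ne, h0, h1, eq_comm, and_comm]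
  vertical_mem s hs t := by
    have h0 := t.2.1
    have h1 := t.2.2
    rcases hs with rfl | rfl <;> simp [lt_iff_le_and_ne, h0, h1, eq_comm, and_comm]
  center_horizontal s hs t ht := by
    obtain ⟨h0, h1⟩ := ht
    rcases hs with rfl | rfl
    · simp [nearestMidpoint, h0, h1]
    · simp [nearestMidpoint, h0.not_gt, h1.not_gt]
  center_vertical s hs t ht := by
    obtain ⟨h0, h1⟩ := ht
    rcases hs with rfl | rfl
    · simp [nearestMidpoint, h0.le, h1]
    · simp [nearestMidpoint, h0.le, h1]

/-- The open squares. -/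
noncomputable def squareStars : StarRule where
  onV := False
  onE := ∅
  onF := {p | (0 < p.1 ∧ p.1 < 1) ∧ 0 < p.2 ∧ p.2 < 1}
  centerE _ := half
  centerF _ := (half, half)
  isOpen_onE := isOpen_empty
  isOpen_onF := ((isOpen_lt (by fun_prop) (by fun_prop)).inter
    (isOpen_lt (by fun_prop) (by fun_prop))).inter ((isOpen_lt (by fun_prop) (by fun_prop)).inter
    (isOpen_lt (by fun_prop) (by fun_prop)))
  eventually_centerE _ _ := .of_forall fun _ => rfl
  eventually_centerF _ _ := .of_forall fun _ => rfl
  zero_mem := by simp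
  one_mem := by simp
  center_zero h := h.elim
  center_one h := h.elim
  horizontal_mem s hs t := by rcases hs with rfl | rfl <;> simp
  vertical_mem s hs t := by rcases hs with rfl | rfl <;> simp
  center_horizontal s hs t ht := ht.elim
  center_vertical s hs t ht := ht.elim

variable {K : SquareComplex.{u}}

theorem exists_mem_star_edge (e : K.E) (t : I) :
    ∃ r : StarRule, proj (edgePt e t : K.Cells) ∈ r.star := by
  by_cases ht : (t : ℝ) = 1 / 2
  · refine ⟨edgeStars, ?_⟩
    change (0 : ℝ) < t ∧ (t : ℝ) < 1
    norm_num [ht]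
  · exact ⟨vertexStars, ht⟩

theorem exists_mem_star (x : K.Realization) : ∃ r : StarRule, x ∈ r.star := by
  obtain ⟨z, rfl⟩ := isQuotientMap_proj.surjective x
  rcases z with v | ⟨e, t⟩ | ⟨f, a, b⟩
  · exact ⟨vertexStars, trivial⟩
  · exact exists_mem_star_edge e t
  · change ∃ r : StarRule, proj (squarePt f a b) ∈ r.star
    rcases eq_or_ne a 0 with rfl | ha0
    · rw [proj_eq (.left f b)]
      exact exists_mem_star_edge _ _
    rcases eq_or_ne a 1 with rfl | ha1
    · rw [proj_eq (.right f b)]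
      exact exists_mem_star_edge _ _
    rcases eq_or_ne b 0 with rfl | hb0
    · rw [proj_eq (.bottom f a)]
      exact exists_mem_star_edge _ _
    rcases eq_or_ne b 1 with rfl | hb1
    · rw [proj_eq (.top f a)]
      exact exists_mem_star_edge _ _
    exact ⟨squareStars, ⟨unitInterval.pos_iff_ne_zero.2 ha0, unitInterval.lt_one_iff_ne_one.2 ha1⟩,
      unitInterval.pos_iff_ne_zero.2 hb0, unitInterval.lt_one_iff_ne_one.2 hb1⟩

end StarRule

variable {K : SquareComplex.{u}} {b : K.Realization}

/-- The complex is simply connected if there is a family of path classes to a base point which is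
flat along the edges. -/
theorem simplyConnectedSpace_of_isFlat {h : ∀ x : K.Realization, Path.Homotopic.Quotient x b}
    (he : ∀ e, IsFlat h (edgeMap e) 0 1) : SimplyConnectedSpace K.Realization := by
  obtain ⟨h', hE, hF⟩ := exists_isFlat he
  refine simplyConnectedSpace_of_isParallel (h := h') fun p => IsParallel.of_local (fun x => ?_) p
  obtain ⟨r, hr⟩ := StarRule.exists_mem_star x
  exact ⟨_, StarRule.eventually_flow_one hr,
    fun p hp => StarRule.isParallel_of_mem_star hE hF p hp⟩

/-! ### Complexes with the diamond property -/

/-- An edge as a path between vertices. -/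
def edgePath (e : K.E) : Path (vertexMap (K.src e)) (vertexMap (K.tgt e)) where
  toContinuousMap := edgeMap e
  source' := edgeMap_zero e
  target' := edgeMap_one e

/-- The identity path of the interval. -/
def idPath : Path (0 : I) 1 := ⟨ContinuousMap.id I, rfl, rfl⟩

theorem isFlat_edgeMap_iff {h : ∀ x : K.Realization, Path.Homotopic.Quotient x b} {e : K.E} :
    IsFlat h (edgeMap e) 0 1 ↔ IsParallel h (edgePath e) :=
  ⟨fun he => (he idPath).congr fun _ => rfl,
    fun he => IsFlat.of_path (p := idPath) (he.congr fun _ => rfl)⟩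

variable (K) in
/-- Every sequence of edges goes down to the same vertex, and two different edges with the same
source are adjacent sides of a square. -/
structure IsDiamond (rank : K.V → ℕ) (v₀ : K.V) : Prop where
  rank_tgt : ∀ e, rank (K.tgt e) < rank (K.src e)
  src_ne : ∀ e, K.src e ≠ v₀
  exists_edge : ∀ v, v ≠ v₀ → ∃ e, K.src e = v
  -- Both placements are allowed, since the order of the two cuts of a cell is an arbitrary choice.
  exists_square : ∀ e e', K.src e = K.src e' → e ≠ e' →
    ∃ f, K.bottom f = e ∧ K.left f = e' ∨ K.bottom f = e' ∧ K.left f = e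

namespace IsDiamond

variable {rank : K.V → ℕ} {v₀ : K.V}

/-- There are path classes from all vertices to the lowest one which begin with an edge. -/
theorem exists_descent (hK : K.IsDiamond rank v₀) :
    ∃ d : ∀ v : K.V, Path.Homotopic.Quotient (vertexMap v) (vertexMap v₀),
    ∀ v, v ≠ v₀ → ∃ e, K.src e = v ∧
      (Path.Homotopic.Quotient.mk (edgePath e)).trans (d (K.tgt e)) = d (K.src e) := by
  classical
  choose ed hed using hK.exists_edge
  let wf : WellFounded fun v w : K.V => rank v < rank w := (measure rank).wf
  let step (v : K.V) (rec : ∀ w, rank w < rank v →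
      Path.Homotopic.Quotient (vertexMap w) (vertexMap v₀)) :
      Path.Homotopic.Quotient (vertexMap v) (vertexMap v₀) :=
    if hv : v = v₀ then (Path.Homotopic.Quotient.refl _).cast (congrArg vertexMap hv) rfl
    else ((Path.Homotopic.Quotient.mk (edgePath (ed v hv))).trans
      (rec (K.tgt (ed v hv)) ((hK.rank_tgt _).trans_eq (congrArg rank (hed v hv))))).cast
        (congrArg vertexMap (hed v hv).symm) rfl
  let d := wf.fix step
  -- With `e` and `hs` existentially quantified, `v` can be replaced by `K.src e` and the cast
  -- disappears.
  have hd : ∀ v, v ≠ v₀ → ∃ (e : K.E) (hs : K.src e = v),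
      d v = ((Path.Homotopic.Quotient.mk (edgePath e)).trans (d (K.tgt e))).cast
        (congrArg vertexMap hs.symm) rfl := fun v hv =>
    ⟨ed v hv, hed v hv, (wf.fix_eq step v).trans (dif_neg hv)⟩
  refine ⟨d, fun v hv => ?_⟩
  obtain ⟨e, rfl, h⟩ := hd v hv
  exact ⟨e, rfl, by rw [h, Path.Homotopic.Quotient.cast_rfl_rfl]⟩

theorem joined_vertexMap (x : K.Realization) : ∃ v, Joined x (vertexMap v) := by
  have hE : ∀ (e : K.E) (t : I), Joined (edgeMap e t) (vertexMap (K.tgt e)) := fun e t => by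
    rw [← edgeMap_one]
    exact ⟨(PathConnectedSpace.somePath t 1).map (edgeMap e).continuous⟩
  obtain ⟨z, rfl⟩ := isQuotientMap_proj.surjective x
  rcases z with ⟨v, u⟩ | ⟨e, t⟩ | ⟨f, p⟩
  · exact ⟨v, .refl _⟩
  · exact ⟨_, hE e t⟩
  · have h1 : Joined (squareMap f p) (squareMap f (1, 1)) :=
      ⟨(PathConnectedSpace.somePath p (1, 1)).map (squareMap f).continuous⟩
    have h2 : squareMap f (1, 1) = edgeMap (K.top f) 1 := proj_eq (.top f 1)
    rw [h2] at h1
    exact ⟨_, h1.trans (hE _ 1)⟩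

/-- Values away from the vertices are arbitrary and are replaced in `exists_isFlat`; injectivity of
`vertexMap` makes the prescribed values consistent. -/
theorem exists_family_eq
    (d : ∀ v : K.V, Path.Homotopic.Quotient (vertexMap v) (vertexMap v₀)) :
    ∃ h : ∀ x : K.Realization, Path.Homotopic.Quotient x (vertexMap v₀),
      ∀ v, h (vertexMap v) = d v := by
  have key : ∀ x : K.Realization, ∃ c : Path.Homotopic.Quotient x (vertexMap v₀),
      ∀ v (hv : vertexMap v = x), c = (d v).cast hv.symm rfl := fun x => by
    by_cases hx : ∃ v, vertexMap v = x
    · obtain ⟨v, rfl⟩ := hx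
      refine ⟨d v, fun w hw => ?_⟩
      obtain rfl := vertexMap_injective hw
      rw [Path.Homotopic.Quotient.cast_rfl_rfl]
    · obtain ⟨v, ⟨p⟩⟩ := joined_vertexMap x
      exact ⟨(Path.Homotopic.Quotient.mk p).trans (d v), fun w hw => (hx ⟨w, hw⟩).elim⟩
  choose h hh using key
  exact ⟨h, fun v => by rw [hh _ v rfl, Path.Homotopic.Quotient.cast_rfl_rfl]⟩

/-- Strong induction on the rank of the source of `e`. The chosen edge `e'` is flat by construction
of `d`; otherwise `e` is carried around the square it spans with `e'`, whose other two sides start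
at lower rank. -/
theorem simplyConnectedSpace (hK : K.IsDiamond rank v₀) :
    SimplyConnectedSpace K.Realization := by
  obtain ⟨d, hd⟩ := hK.exists_descent
  obtain ⟨h, hh⟩ := exists_family_eq d
  refine simplyConnectedSpace_of_isFlat (h := h) fun e => ?_
  induction hn : rank (K.src e) using Nat.strong_induction_on generalizing e with
  | _ n ih =>
  subst hn
  obtain ⟨e', hs, he'⟩ := hd (K.src e) (hK.src_ne e)
  have hflat : IsFlat h (edgeMap e') 0 1 := isFlat_edgeMap_iff.2 (by rwa [IsParallel, hh, hh])
  by_cases hee : e = e'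
  · rwa [hee]
  obtain ⟨f, hf⟩ := hK.exists_square e e' hs.symm hee
  have hsrc : K.src (K.bottom f) = K.src e ∧ K.src (K.left f) = K.src e := by
    rcases hf with ⟨h1, h2⟩ | ⟨h1, h2⟩ <;> simp [h1, h2, hs]
  have hr : IsFlat h (edgeMap (K.right f)) 0 1 := by
    refine ih _ ?_ _ rfl
    rw [← K.tgt_bottom, ← hsrc.1]
    exact hK.rank_tgt _
  have ht : IsFlat h (edgeMap (K.top f)) 0 1 := by
    refine ih _ ?_ _ rfl
    rw [← K.tgt_left, ← hsrc.2]
    exact hK.rank_tgt _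
  have hr' : IsFlat h (squareMap f) (1, 0) (1, 1) := isFlat_side (squareMap_right f) hr
  have ht' : IsFlat h (squareMap f) (0, 1) (1, 1) := isFlat_side (squareMap_top f) ht
  rcases hf with ⟨rfl, rfl⟩ | ⟨rfl, rfl⟩
  · have hl : IsFlat h (squareMap f) (0, 0) (0, 1) := isFlat_side (squareMap_left f) hflat
    rw [← squareMap_bottom f]
    exact IsFlat.comp ((hl.trans ht').trans hr'.symm)
  · have hb : IsFlat h (squareMap f) (0, 0) (1, 0) := isFlat_side (squareMap_bottom f) hflat
    rw [← squareMap_left f]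
    exact IsFlat.comp ((hb.trans hr').trans ht'.symm)

end IsDiamond

end SquareComplex

universe u

/-! ### Cut systems on a surface of genus zero -/

section Genus

/-- Makes the components of the complement of the cuts open, as `isConnected_diff` requires. -/
theorem locallyConnectedSpace_halfSpace : LocallyConnectedSpace (EuclideanHalfSpace 2) := by
  have hc : Convex ℝ {x : EuclideanSpace ℝ (Fin 2) | 0 ≤ x 0} :=
    convex_halfSpace_ge (f := fun x : EuclideanSpace ℝ (Fin 2) => x 0)
      ⟨fun _ _ => rfl, fun _ _ => rfl⟩ 0
  have : LocallyPathConnectedSpace (EuclideanHalfSpace 2) := hc.locallyPathConnectedSpace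
  infer_instance

variable {M : Type u} [TopologicalSpace M]

/-- If a region `W` stays connected when the closed set `A ⊆ W` is removed, so does every connected
set that contains `W`. -/
theorem isConnected_diff {N W A : Set M} (hN : IsPreconnected N) (hW : IsOpen W)
    (hA : IsClosed A) (hAW : A ⊆ W) (hWN : W ⊆ N) (hWA : IsConnected (W \ A)) :
    IsConnected (N \ A) := by
  -- If `Q` misses `W \ A`, then `P ∪ W` and `Q \ A` form an open cover of `N`; a common point in
  -- `N` cannot lie in `W`, hence lies in `P ∩ Q`.
  have key : ∀ P Q : Set M, IsOpen P → IsOpen Q → N \ A ⊆ P ∪ Q → ((N \ A) ∩ Q).Nonempty →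
      ¬ ((W \ A) ∩ Q).Nonempty → ((N \ A) ∩ (P ∩ Q)).Nonempty := by
    intro P Q hP hQ hPQ hnQ hWQ
    obtain ⟨w, hw, -⟩ := hWA.nonempty
    obtain ⟨y, ⟨hyN, hyA⟩, hyQ⟩ := hnQ
    obtain ⟨x, hxN, hx, hxQ, hxA⟩ := hN (P ∪ W) (Q \ A) (hP.union hW) (hQ.sdiff hA)
      (fun x hx => by
        by_cases hxA : x ∈ A
        · exact .inl (.inr (hAW hxA))
        · rcases hPQ ⟨hx, hxA⟩ with h | h
          · exact .inl (.inl h)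
          · exact .inr ⟨h, hxA⟩)
      ⟨w, hWN hw, .inr hw⟩ ⟨y, hyN, hyQ, hyA⟩
    rcases hx with hx | hx
    · exact ⟨x, ⟨hxN, hxA⟩, hx, hxQ⟩
    · exact (hWQ ⟨x, ⟨hx, hxA⟩, hxQ⟩).elim
  have hsub : W \ A ⊆ N \ A := sdiff_subset_sdiff_left hWN
  refine ⟨hWA.nonempty.mono hsub, fun P Q hP hQ hPQ hnP hnQ => ?_⟩
  by_cases h1 : ((W \ A) ∩ P).Nonempty
  · by_cases h2 : ((W \ A) ∩ Q).Nonempty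
    · exact (hWA.isPreconnected P Q hP hQ (hsub.trans hPQ) h1 h2).mono
        (inter_subset_inter_left _ hsub)
    · exact key P Q hP hQ hPQ hnQ h2
  · rw [inter_comm P Q]
    exact key Q P hQ hP (by rwa [union_comm]) hnP h1

variable [ChartedSpace (EuclideanHalfSpace 2) M]

theorem IsCurveSystem.isClosed [T2Space M] {C : Set (Set M)} (hC : IsCurveSystem C) :
    IsClosed (⋃₀ C) := by
  rw [sUnion_eq_biUnion]
  refine hC.1.isClosed_biUnion fun c hc => ?_
  obtain ⟨⟨γ, hγ, rfl⟩, -⟩ := hC.2.1 c hc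
  exact (isCompact_range hγ.isEmbedding.continuous).isClosed

theorem IsCurveSystem.mono {C C' : Set (Set M)} (hC : IsCurveSystem C) (h : C' ⊆ C) :
    IsCurveSystem C' :=
  ⟨hC.1.subset h, fun c hc => hC.2.1 c (h hc), hC.2.2.subset h⟩

/-- A component of the complement of curves has at most the genus of the surface. -/
theorem genus_component_le [T2Space M] {C : Set (Set M)} (hC : IsCurveSystem C) {x : M}
    (hx : x ∈ (⋃₀ C)ᶜ) : genus (connectedComponentIn (⋃₀ C)ᶜ x) ≤ genus (univ : Set M) := by
  have := locallyConnectedSpace_halfSpace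
  have : LocallyConnectedSpace M := ChartedSpace.locallyConnectedSpace (EuclideanHalfSpace 2) M
  set W := connectedComponentIn (⋃₀ C)ᶜ x with hW
  have hWo : IsOpen W := hC.isClosed.isOpen_compl.connectedComponentIn
  have hxW : x ∈ W := mem_connectedComponentIn hx
  have hWc : IsPreconnected W := isPreconnected_connectedComponentIn
  have hWx : W ⊆ connectedComponent x := hWc.subset_connectedComponent hxW
  refine iSup_le fun ⟨F, hF, hFW, hFn⟩ => ?_
  refine le_iSup_of_le (⟨F, hF, subset_univ _, fun y _ => ?_⟩ :
    {F : Set (Set M) // IsCurveSystem F ∧ ⋃₀ F ⊆ univ ∧ IsNonseparating univ F}) le_rfl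
  rw [connectedComponentIn_univ]
  -- The curves of `F` all lie in the component of `x`, so any other component is untouched.
  by_cases hxy : connectedComponent x = connectedComponent y
  · rw [← hxy]
    have h1 := hFn x hxW
    rw [hWc.connectedComponentIn hxW] at h1
    exact isConnected_diff isPreconnected_connectedComponent hWo hF.isClosed hFW hWx h1
  · have hd : Disjoint (connectedComponent y) (⋃₀ F) :=
      (connectedComponent_disjoint hxy).symm.mono_right (hFW.trans hWx)
    rw [hd.sdiff_eq_left]
    exact isConnected_connectedComponent

/-- This is how genus `0` is used: any subset of a cut system is again a cut system. -/
theorem IsCurveSystem.isCutSystem [T2Space M] (hg : genus (univ : Set M) = 0) {C : Set (Set M)}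
    (hC : IsCurveSystem C) : IsCutSystem C :=
  ⟨hC, fun _ hx => nonpos_iff_eq_zero.1 ((genus_component_le hC hx).trans_eq hg)⟩

theorem isCurveSystem_empty : IsCurveSystem (∅ : Set (Set M)) :=
  ⟨finite_empty, fun _ h => h.elim, pairwiseDisjoint_empty⟩

end Genus

/-! ### The diamond property of the cut complex -/

namespace ESurface

variable {M : Type u} [TopologicalSpace M] [ChartedSpace (EuclideanHalfSpace 2) M]
  (S : ESurface M)

/-- The number of cuts. -/
noncomputable def cutCount : S.Vertex → ℕ :=
  Quotient.lift (fun C => C.cuts.ncard) fun C C' ⟨φ, _, h⟩ => by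
    rw [← h, moveCurves, ncard_image_of_injective _ φ.injective.image_injective]

theorem edge_eq {p p' : PointedCutSystem M} {φ : M ≃ₜ M} (h : S.IsotopicToId φ)
    (h' : moveCurves φ p.cuts = p'.cuts) (h'' : φ '' p.c = p'.c) : S.edge p = S.edge p' :=
  Quotient.sound (s := S.pointedSetoid) ⟨φ, h, h', h''⟩

theorem cutCount_target_lt (e : S.Edge) : S.cutCount (S.target e) < S.cutCount (S.source e) := by
  induction e using Quotient.inductionOn with
  | h p => exact ncard_sdiff_singleton_lt_of_mem p.mem p.isCutSystem.1.1

theorem exists_square [T2Space M] (hg : genus (univ : Set M) = 0) (e e' : S.Edge)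
    (he : S.source e = S.source e') (hne : e ≠ e') :
    ∃ f : S.Cell, (S.edge f.out.first₁ = e ∧ S.edge f.out.first₂ = e') ∨
      (S.edge f.out.first₁ = e' ∧ S.edge f.out.first₂ = e) := by
  obtain ⟨p, rfl⟩ : ∃ p, S.edge p = e := Quotient.exists_rep e
  obtain ⟨p', rfl⟩ : ∃ p', S.edge p' = e' := Quotient.exists_rep e'
  -- The isotopy moves both removals onto the single cut system `p'.cuts`.
  obtain ⟨φ, hφ, hmove⟩ := Quotient.exact he
  change moveCurves φ p.cuts = p'.cuts at hmove
  have hmem : φ '' p.c ∈ p'.cuts := hmove ▸ mem_image_of_mem _ p.mem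
  have hcut : ∀ C ⊆ p'.cuts, IsCutSystem C := fun C hC => (p'.isCutSystem.1.mono hC).isCutSystem hg
  let p₁ : PointedCutSystem M :=
    ⟨p'.cuts, φ '' p.c, hmem, p'.isCutSystem, hcut _ sdiff_subset⟩
  have hp : S.edge p = S.edge p₁ := S.edge_eq hφ hmove rfl
  -- If the two cuts coincided, `φ` would identify the two edges.
  have hc : φ '' p.c ≠ p'.c := fun hc => hne (S.edge_eq hφ hmove hc)
  let q : BipointedCutSystem M :=
    ⟨p'.cuts, φ '' p.c, p'.c, hmem, p'.mem, hc, p'.isCutSystem, hcut _ sdiff_subset,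
      p'.removable, hcut _ (sdiff_subset.trans sdiff_subset)⟩
  let f : S.Cell := Quotient.mk S.bipointedSetoid q
  -- The representative `f.out` is only isotopic to `q` and may list the two cuts in the other
  -- order, whence the two alternatives.
  obtain ⟨ψ, hψ, hcuts, hpair⟩ : S.bipointedSetoid f.out q :=
    Quotient.mk_out (s := S.bipointedSetoid) q
  rw [moveCurves, image_pair, pair_eq_pair_iff] at hpair
  rw [hp]
  refine ⟨f, hpair.imp (fun h => ?_) fun h => ?_⟩
  · exact ⟨S.edge_eq hψ hcuts h.1, S.edge_eq hψ hcuts h.2⟩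
  · exact ⟨S.edge_eq hψ hcuts h.1, S.edge_eq hψ hcuts h.2⟩

theorem isDiamond [T2Space M] (hg : genus (univ : Set M) = 0) :
    (cutComplex S).IsDiamond S.cutCount
      (S.vertex ⟨∅, isCurveSystem_empty.isCutSystem hg⟩) where
  rank_tgt := S.cutCount_target_lt
  src_ne e he := by
    have h := S.cutCount_target_lt e
    have h0 : S.cutCount (S.source e) = 0 := (congrArg S.cutCount he).trans (ncard_empty _)
    omega
  exists_edge v hv := by
    induction v using Quotient.inductionOn with
    | h C =>
    rcases C.cuts.eq_empty_or_nonempty with h0 | ⟨c, hc⟩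
    · obtain ⟨cuts, hC⟩ := C
      obtain rfl : cuts = ∅ := h0
      exact (hv rfl).elim
    · exact ⟨S.edge ⟨C.cuts, c, hc, C.isCutSystem,
        (C.isCutSystem.1.mono sdiff_subset).isCutSystem hg⟩, rfl⟩
  exists_square := S.exists_square hg

end ESurface

end CutComplex

theorem mainTheorem6 {M : Type*} [TopologicalSpace M] [ChartedSpace (EuclideanHalfSpace 2) M]
    [IsManifold (𝓡∂ 2) ∞ M] [T2Space M] [CompactSpace M]
    (S : CutComplex.ESurface M) (hS : S.surfaceGenus = 0) :
    ConnectedSpace (CutComplex.cutComplex S).Realization ∧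
      SimplyConnectedSpace (CutComplex.cutComplex S).Realization := by
  have h : SimplyConnectedSpace (CutComplex.cutComplex S).Realization :=
    (S.isDiamond hS).simplyConnectedSpace
  exact ⟨inferInstance, h⟩
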